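/- \textbf{Setting.} The quality space is $\{L,H\}=\{0,1\}$, with uniform prior $\pi_0(0)=\pi_0(1)=\tfrac12$. Given $\eta\in(0,\tfrac12)$, the quality process is $Q_0=X_0$ and, for $t\ge 0$, $Q_{t+1}=X_{t+1}$ if $B_{t+1}=1$ and $Q_{t+1}=Q_t$ if $B_{t+1}=0$, where the $X_t$ are uniform on $\{0,1\}$ and the $B_t$ are Bernoulli with parameter $\eta$. Consumer $t\ge 1$ has a preference $\theta_t$ with law $\mu_\theta$ and a noise $\varepsilon_t$ with law $\mu_\varepsilon$. All the variables $\theta_t,\varepsilon_t,X_t,B_t$ are independent. Let $r(q,\theta)\in\mathbb R$ be a measurable reward function and $f(q,\theta,\varepsilon)\in\mathcal Z$ a measurable feedback function with values in a finite set $\mathcal Z$. For a belief $\pi$ (a probability distribution on $\{0,1\}$), a consumer with preference $\theta$ buys if and only if $\sum_q \pi(q)r(q,\theta)>0$. Her observable feedback under quality $q$ and noise $\varepsilon$ is $f(q,\theta,\varepsilon)$ if she buys and the symbol $*\notin\mathcal Z$ if she does not. For $z\in\mathcal Z\cup\{*\}$ let $G(z,\pi,q)$ be the probability, over independent $\theta\sim\mu_\theta$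 and $\varepsilon\sim\mu_\varepsilon$, that this feedback equals $z$, and let $G(z,\pi)=\sum_q\pi(q)G(z,\pi,q)$. \textbf{Assumptions.} (1) For every $\theta$, $r(q,\theta)$ is non-decreasing in $q$, and $\mathbb P(r(0,\theta_t)>0)\ge\delta$ for some $\delta>0$. (2) For every belief $\pi$ and all $q\neq q'$: $G(z,\pi,q)>0$ for every $z\in\mathcal Z$, and $G(z,\pi,q)\neq G(z,\pi,q')$ for some $z\in\mathcal Z$. \textbf{Imperfect learners.} They update their belief as if the quality were stationary: $\pi^{\mathrm{imp}}_1=\pi_0$ and, for $t\ge1$, $$\pi^{\mathrm{imp}}_{t+1}(q)=\frac{G(Z_t,\pi^{\mathrm{imp}}_t,q)}{G(Z_t,\pi^{\mathrm{imp}}_t)}\,\pi^{\mathrm{imp}}_t(q),$$ where $Z_t$ is the observable feedback of consumer $t$ under belief $\pi^{\mathrm{imp}}_t$, quality $Q_t$, preference $\theta_t$ and noise $\varepsilon_t$. Their loss is $\mathcal L^{\mathrm{imp}}_T=\sum_{t=1}^T\mathbb E[1-\pi^{\mathrm{imp}}_t(Q_t)]$. \textbf{Theorem.} If $\eta T=\Omega(1)$,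 then $\mathcal L^{\mathrm{imp}}_T=\Omega(T)$. That is: for given $r,f,\mu_\theta,\mu_\varepsilon$ satisfying (1) and (2) and every $c_0>0$, there is a constant $c>0$ such that for all integers $T\ge1$ and all $\eta\in(0,\tfrac12)$ with $\eta T\ge c_0$, $$\mathcal L^{\mathrm{imp}}_T\ \ge\ c\,T .$$ -/

import Mathlib

open MeasureTheory ProbabilityTheory

noncomputable section

namespace SocialLearning

/-- The quality space `{L, H} = {0, 1}`. Beliefs on it are the elements of
`stdSimplex ℝ Quality`. -/
abbrev Quality : Type := Fin 2

/-- The uniform prior. -/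
def prior : Quality → ℝ := fun _ => 1 / 2

section Market

variable {Θ E 𝓩 : Type*}

/-- Expected reward of purchasing, for a consumer with belief `π` and preference `θ`. -/
def expectedReward (r : Quality → Θ → ℝ) (π : Quality → ℝ) (θ : Θ) : ℝ :=
  ∑ q, π q * r q θ

/-- The observation left by a consumer with belief `π`, preference `θ` and noise `e` when the
quality is `q`: the review `f q θ e` if she buys (expected reward positive), and `none`
(written `∗` in the literature) if she does not buy. -/
def observation (r : Quality → Θ → ℝ) (f : Quality → Θ → E → 𝓩)
    (π : Quality → ℝ) (q : Quality) (θ : Θ) (e : E) : Option 𝓩 :=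
  if 0 < expectedReward r π θ then some (f q θ e) else none

variable [MeasurableSpace Θ] [MeasurableSpace E]

/-- `G z π q`: probability of the observation `z` under belief `π` and quality `q`, where the
preference has law `μΘ` and the noise, independent of it, has law `μE`. -/
def G (r : Quality → Θ → ℝ) (f : Quality → Θ → E → 𝓩) (μΘ : Measure Θ) (μE : Measure E)
    (z : Option 𝓩) (π : Quality → ℝ) (q : Quality) : ℝ :=
  (μΘ.prod μE).real {x | observation r f π q x.1 x.2 = z}

/-- `G z π`, the average of `G z π q` over `q` drawn from `π`. -/
def Gavg (r : Quality → Θ → ℝ) (f : Quality → Θ → E → 𝓩) (μΘ : Measure Θ) (μE : Measure E)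
    (z : Option 𝓩) (π : Quality → ℝ) : ℝ :=
  ∑ q, π q * G r f μΘ μE z π q

/-- Purchase guarantee: the reward is non-decreasing in the quality, and a positive fraction of
the consumers has a positive reward at the lowest quality. -/
def PurchaseGuarantee (r : Quality → Θ → ℝ) (μΘ : Measure Θ) : Prop :=
  (∀ θ, Monotone fun q => r q θ) ∧ ∃ δ > 0, δ ≤ μΘ.real {θ | 0 < r 0 θ}

/-- Identifiability: under every belief, each review has positive probability, and the review
distributions under the two qualities differ. -/
def Identifiable (r : Quality → Θ → ℝ) (f : Quality → Θ → E → 𝓩) (μΘ : Measure Θ)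
    (μE : Measure E) : Prop :=
  ∀ π ∈ stdSimplex ℝ Quality, ∀ q q' : Quality, q ≠ q' →
    (∀ z : 𝓩, 0 < G r f μΘ μE (some z) π q) ∧
      ∃ z : 𝓩, G r f μΘ μE (some z) π q ≠ G r f μΘ μE (some z) π q'

/-- Bayes' rule of the stationary model after the observation `z`. -/
def stationaryUpdate (r : Quality → Θ → ℝ) (f : Quality → Θ → E → 𝓩) (μΘ : Measure Θ)
    (μE : Measure E) (z : Option 𝓩) (π : Quality → ℝ) : Quality → ℝ :=
  fun q => G r f μΘ μE z π q / Gavg r f μΘ μE z π * π q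

end Market

section Dynamics

variable {Θ E 𝓩 Ω : Type*} [MeasurableSpace Θ] [MeasurableSpace E]

/-- The quality process: `Q 0 = X 0`, and `Q (t + 1)` is the fresh draw `X (t + 1)` if the
redraw coin `B (t + 1)` shows `true`, and `Q t` otherwise. -/
def quality (X : ℕ → Ω → Quality) (B : ℕ → Ω → Bool) : ℕ → Ω → Quality
  | 0, ω => X 0 ω
  | t + 1, ω => if B (t + 1) ω then X (t + 1) ω else quality X B t ω

/-- The belief `π t` of imperfect learners. The first consumer arrives at time `1`, so that
`π 1` is the prior (and `π 0` is set to the prior); `π (t + 1)` comes from `π t` by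
the stationary Bayes rule applied to the observation left by consumer `t`, whose purchase decision
is itself based on `π t`, while her review depends on the current quality. -/
def posteriorImp (r : Quality → Θ → ℝ) (f : Quality → Θ → E → 𝓩) (μΘ : Measure Θ)
    (μE : Measure E) (θ : ℕ → Ω → Θ) (ε : ℕ → Ω → E) (Q : ℕ → Ω → Quality) :
    ℕ → Ω → Quality → ℝ
  | 0, _ => prior
  | 1, _ => prior
  | t + 2, ω =>
    stationaryUpdate r f μΘ μE
      (observation r f (posteriorImp r f μΘ μE θ ε Q (t + 1) ω) (Q (t + 1) ω)
        (θ (t + 1) ω) (ε (t + 1) ω))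
      (posteriorImp r f μΘ μE θ ε Q (t + 1) ω)

variable [MeasurableSpace Ω]

/-- The random inputs of the dynamic model with redraw probability `η`: preferences `θ t` with law
`μΘ`, noises `ε t` with law `μE`, uniform fresh qualities `X t`, and coins `B t` that show `true`
with probability `η`; all these variables are independent, over all times and all four kinds. -/
structure IsDynamicModel (P : Measure Ω) (μΘ : Measure Θ) (μE : Measure E) (η : ℝ)
    (θ : ℕ → Ω → Θ) (ε : ℕ → Ω → E) (X : ℕ → Ω → Quality) (B : ℕ → Ω → Bool) : Prop where
  measurable_preference : ∀ t, Measurable (θ t)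
  measurable_noise : ∀ t, Measurable (ε t)
  measurable_draw : ∀ t, Measurable (X t)
  measurable_coin : ∀ t, Measurable (B t)
  law : ∀ t, P.map (fun ω => (θ t ω, ε t ω, X t ω, B t ω)) =
    μΘ.prod (μE.prod ((uniformOn (Set.univ : Set Quality)).prod
      (ENNReal.ofReal η • Measure.dirac true + ENNReal.ofReal (1 - η) • Measure.dirac false)))
  indep : iIndepFun (fun t ω => (θ t ω, ε t ω, X t ω, B t ω)) P

/-- The loss `∑ t = 1, …, T, 𝔼[1 - π t (Q t)]` of imperfect learners. -/
def lossImp (r : Quality → Θ → ℝ) (f : Quality → Θ → E → 𝓩) (μΘ : Measure Θ)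
    (μE : Measure E) (P : Measure Ω) (θ : ℕ → Ω → Θ) (ε : ℕ → Ω → E)
    (X : ℕ → Ω → Quality) (B : ℕ → Ω → Bool) (T : ℕ) : ℝ :=
  ∑ t ∈ Finset.Icc 1 T,
    ∫ ω, (1 - posteriorImp r f μΘ μE θ ε (quality X B) t ω (quality X B t ω)) ∂P

end Dynamics

end SocialLearning

end

/-!
Call *optimism* the positive part of the log-odds of high quality. While the quality is high, the
drift of the log-odds is the relative entropy between the two laws of the observation. By
identifiability this is positive at every belief and tends to a positive limit as the belief tends
to certainty of high quality, so in expectation the optimism grows linearly in time, except for an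
amount controlled by the loss. A redraw to low quality then finds an over-optimistic public, which
pays a constant loss per consumer until its optimism has been worked off.

Let `l n` be the expected loss of a consumer and `v n` the expected optimism on the event of low
quality. The log-odds have bounded increments, so `v n ≤ C * n * l n`. On the other hand, each
redraw moves a fraction of the linearly growing optimism of high quality into `v`, so `v n` grows
like `η * n ^ 2` up to a multiple of the total loss. Summing over `n` compares a cubic in `T` with
`T` times the total loss.
-/

noncomputable section

namespace SocialLearning

open Filter Topology

section Recursion

lemma add_sum_le_add_sum_of_succ {x b c : ℕ → ℝ} {n : ℕ}
    (h : ∀ i < n, x i + c i ≤ x (i + 1) + b i) :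
    x 0 + ∑ i ∈ Finset.range n, c i ≤ x n + ∑ i ∈ Finset.range n, b i := by
  have hsum : ∑ i ∈ Finset.range n, (c i - b i) ≤ ∑ i ∈ Finset.range n, (x (i + 1) - x i) :=
    Finset.sum_le_sum fun i hi => by linarith [h i (Finset.mem_range.1 hi)]
  rw [Finset.sum_sub_distrib, Finset.sum_range_sub] at hsum
  linarith

lemma sum_range_add_one (n : ℕ) :
    ∑ i ∈ Finset.range n, ((i : ℝ) + 1) = n * (n + 1) / 2 := by
  induction n with
  | zero => simp
  | succ n ih => rw [Finset.sum_range_succ, ih]; push_cast; ring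

lemma sum_range_mul_add_one (n : ℕ) :
    ∑ i ∈ Finset.range n, (i : ℝ) * (i + 1) = n * ((n : ℝ) ^ 2 - 1) / 3 := by
  induction n with
  | zero => simp
  | succ n ih => rw [Finset.sum_range_succ, ih]; push_cast; ring

variable {η k C : ℝ} {a v l : ℕ → ℝ}

lemma mul_le_add_sum_of_succ (hC : 0 ≤ C) (hl : ∀ n, 0 ≤ l n) (ha₀ : 0 ≤ a 0)
    (ha : ∀ n, a n + k ≤ a (n + 1) + C * l n) {n T : ℕ} (hn : n ≤ T) :
    n * k ≤ a n + C * ∑ i ∈ Finset.range T, l i := by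
  have h := add_sum_le_add_sum_of_succ (n := n) fun i _ => ha i
  rw [← Finset.mul_sum, Finset.sum_const, Finset.card_range, nsmul_eq_mul] at h
  have hsum : ∑ i ∈ Finset.range n, l i ≤ ∑ i ∈ Finset.range T, l i :=
    Finset.sum_le_sum_of_subset_of_nonneg (Finset.range_mono hn) fun i _ _ => hl i
  linarith [mul_le_mul_of_nonneg_left hsum hC]

lemma quadratic_le_add_sum (hη : 0 ≤ η) (hC : 0 ≤ C) (hl : ∀ n, 0 ≤ l n)
    (ha₀ : 0 ≤ a 0) (hv₀ : 0 ≤ v 0)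
    (ha : ∀ n, a n + k ≤ a (n + 1) + C * l n)
    (hv : ∀ n, η / 2 * a (n + 1) + (1 - η) * (v n - C * l n) ≤ v (n + 1))
    (hvl : ∀ n, v n ≤ C * n * l n) {n T : ℕ} (hn : n ≤ T) :
    η * k / 4 * (n * (n + 1)) ≤
      v n + C * (1 + 3 / 2 * (η * T)) * ∑ i ∈ Finset.range T, l i := by
  set S := ∑ i ∈ Finset.range T, l i
  have hsum : ∑ i ∈ Finset.range n, l i ≤ S :=
    Finset.sum_le_sum_of_subset_of_nonneg (Finset.range_mono hn) fun i _ _ => hl i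
  have hS : 0 ≤ S := Finset.sum_nonneg fun i _ => hl i
  have hnT : (n : ℝ) ≤ T := by exact_mod_cast hn
  have hstep : ∀ i < n, v i + (η * k / 2 * (i + 1) - η / 2 * C * S) ≤
      v (i + 1) + C * (1 + η * T) * l i := fun i hi => by
    have hiT : (i : ℝ) ≤ T := by exact_mod_cast hi.le.trans hn
    have hgrow := mul_le_mul_of_nonneg_left
      (mul_le_add_sum_of_succ hC hl ha₀ ha (n := i + 1) (T := T) (by lia)) hη
    have hlow : η * v i ≤ η * (C * T * l i) := by
      have := hl i
      exact mul_le_mul_of_nonneg_left ((hvl i).trans (by gcongr)) hη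
    push_cast at hgrow
    linarith [hv i, mul_nonneg hη (mul_nonneg hC (hl i))]
  have h := add_sum_le_add_sum_of_succ hstep
  rw [← Finset.mul_sum, Finset.sum_sub_distrib, Finset.sum_const, Finset.card_range,
    nsmul_eq_mul, ← Finset.mul_sum, sum_range_add_one] at h
  have hη' : η * C * n * S ≤ η * C * T * S := by gcongr
  have hl' := mul_le_mul_of_nonneg_left hsum (by positivity : 0 ≤ C * (1 + η * T))
  linarith

/-- Summing the quadratic lower bound on `v` a second time gives a cubic, whereas `v n` is at most
`C * n * l n`. -/
lemma mul_sq_le_mul_sum (hη : 0 ≤ η) (hC : 0 ≤ C) (hl : ∀ n, 0 ≤ l n)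
    (ha₀ : 0 ≤ a 0) (hv₀ : 0 ≤ v 0)
    (ha : ∀ n, a n + k ≤ a (n + 1) + C * l n)
    (hv : ∀ n, η / 2 * a (n + 1) + (1 - η) * (v n - C * l n) ≤ v (n + 1))
    (hvl : ∀ n, v n ≤ C * n * l n) (hk : k ≤ C * l 0) (T : ℕ) :
    k * (η * T) * T ≤ 24 * C * (1 + η * T) * ∑ i ∈ Finset.range T, l i := by
  rcases T.eq_zero_or_pos with rfl | hT
  · simp
  set S := ∑ i ∈ Finset.range T, l i
  have hT1 : (1 : ℝ) ≤ T := by exact_mod_cast hT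
  have hS : 0 ≤ S := Finset.sum_nonneg fun i _ => hl i
  have hvsum : ∑ i ∈ Finset.range T, v i ≤ C * T * S := by
    rw [Finset.mul_sum]
    refine Finset.sum_le_sum fun i hi => (hvl i).trans ?_
    have := hl i
    have : (i : ℝ) ≤ T := by exact_mod_cast (Finset.mem_range.1 hi).le
    gcongr
  have hquad := Finset.sum_le_sum fun i (hi : i ∈ Finset.range T) =>
    quadratic_le_add_sum hη hC hl ha₀ hv₀ ha hv hvl (Finset.mem_range.1 hi).le
  rw [← Finset.mul_sum, sum_range_mul_add_one, Finset.sum_add_distrib, Finset.sum_const,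
    Finset.card_range, nsmul_eq_mul] at hquad
  have hcubic : η * k * ((T : ℝ) ^ 2 - 1) ≤ C * (24 + 18 * (η * T)) * S := by
    refine le_of_mul_le_mul_left ?_ (by positivity : (0 : ℝ) < T)
    linarith
  have hkS : η * k ≤ η * T * (C * S) := by
    have hl₀ : l 0 ≤ S := Finset.single_le_sum (fun i _ => hl i) (Finset.mem_range.2 hT)
    calc η * k ≤ η * (C * S) := by gcongr; exact hk.trans (by gcongr)
      _ ≤ η * T * (C * S) := by gcongr; nlinarith
  linarith [mul_nonneg (mul_nonneg hη (Nat.cast_nonneg T)) (mul_nonneg hC hS)]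

end Recursion

section Independence

lemma isProbabilityMeasure_right_of_prod {α β : Type*} [MeasurableSpace α] [MeasurableSpace β]
    (μ : Measure α) [IsProbabilityMeasure μ] (ν : Measure β) [SFinite ν]
    [IsProbabilityMeasure (μ.prod ν)] : IsProbabilityMeasure ν := by
  rw [← Measure.snd_prod (μ := μ) (ν := ν)]
  infer_instance

variable {Ω α β γ : Type*} [MeasurableSpace Ω] [MeasurableSpace α] [MeasurableSpace β]
  {P : Measure Ω}

lemma measurable_and_indepFun_of_recursion {U : ℕ → Ω → β} (hU : ∀ t, Measurable (U t))
    (hind : iIndepFun U P) {φ : β → α} (hφ : Measurable φ) {F : α × β → α} (hF : Measurable F)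
    {S : ℕ → Ω → α} (hzero : ∀ ω, S 0 ω = φ (U 0 ω))
    (hsucc : ∀ t ω, S (t + 1) ω = F (S t ω, U (t + 1) ω)) (t : ℕ) :
    Measurable (S t) ∧ IndepFun (S t) (U (t + 1)) P := by
  set past : ℕ → MeasurableSpace Ω := fun t =>
    ⨆ i ∈ Set.Iic t, MeasurableSpace.comap (U i) inferInstance
  have hUpast {i t : ℕ} (h : i ≤ t) : Measurable[past t] (U i) :=
    (comap_measurable (U i)).mono
      (le_iSup₂ (f := fun i (_ : i ∈ Set.Iic t) => MeasurableSpace.comap (U i) inferInstance) i h)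
      le_rfl
  have hS (t : ℕ) : Measurable[past t] (S t) := by
    induction t with
    | zero =>
      rw [funext hzero]
      exact hφ.comp (hUpast le_rfl)
    | succ t ih =>
      rw [funext (hsucc t)]
      have ih' := ih.mono (biSup_mono fun i (hi : i ∈ Set.Iic t) =>
        Set.Iic_subset_Iic.2 t.le_succ hi) le_rfl
      exact hF.comp (ih'.prodMk (hUpast le_rfl))
  refine ⟨(hS t).mono (iSup₂_le fun i _ => (hU i).comap_le) le_rfl, ?_⟩
  have hindep := indep_iSup_of_disjoint (fun i => (hU i).comap_le) hind.iIndep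
    (S := Set.Iic t) (T := {t + 1}) (by simp)
  rw [iSup_singleton] at hindep
  exact (IndepFun_iff_Indep _ _ _).2 (indep_of_indep_of_le_left hindep (hS t).comap_le)

variable [MeasurableSpace γ] [IsFiniteMeasure P]

lemma indepFun_prodMk_left {X : Ω → α} {Y : Ω → β} {Z : Ω → γ} (hX : AEMeasurable X P)
    (hY : AEMeasurable Y P) (hZ : AEMeasurable Z P)
    (hXYZ : IndepFun X (fun ω => (Y ω, Z ω)) P) (hYZ : IndepFun Y Z P) :
    IndepFun (fun ω => (X ω, Y ω)) Z P := by
  have hlX : HasLaw X (P.map X) P := ⟨hX, rfl⟩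
  have hlY : HasLaw Y (P.map Y) P := ⟨hY, rfl⟩
  have hlZ : HasLaw Z (P.map Z) P := ⟨hZ, rfl⟩
  have hlYZ := hYZ.hasLaw_prod hlY hlZ
  have hlXY := (hXYZ.comp measurable_id measurable_fst).hasLaw_prod hlX hlY
  have hlXYZ := hXYZ.hasLaw_prod hlX hlYZ
  refine (indepFun_iff_hasLaw_prodMk_prod hlXY hlZ).2 ⟨by fun_prop, ?_⟩
  apply MeasurableEquiv.map_measurableEquiv_injective MeasurableEquiv.prodAssoc
  rw [Measure.prodAssoc_prod, ← hlXYZ.map_eq,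
    AEMeasurable.map_map_of_aemeasurable (by fun_prop) (by fun_prop)]
  rfl

lemma integral_prodMk_of_indepFun {X : Ω → α} {Y : Ω → β} {ν : Measure β} [SFinite ν]
    {g : α × β → ℝ} (hX : AEMeasurable X P) (hY : HasLaw Y ν P) (hXY : IndepFun X Y P)
    (hg : Measurable g) (hint : Integrable (fun ω => g (X ω, Y ω)) P) :
    Integrable (fun ω => ∫ y, g (X ω, y) ∂ν) P ∧
      ∫ ω, g (X ω, Y ω) ∂P = ∫ ω, ∫ y, g (X ω, y) ∂ν ∂P := by
  have hlX : HasLaw X (P.map X) P := ⟨hX, rfl⟩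
  have hlXY := hXY.hasLaw_prod hlX hY
  have hint' : Integrable g ((P.map X).prod ν) := by
    rw [← hlXY.map_eq]
    exact (integrable_map_measure hg.aestronglyMeasurable hlXY.aemeasurable).2 hint
  have hm : AEStronglyMeasurable (fun x => ∫ y, g (x, y) ∂ν) (P.map X) :=
    hg.stronglyMeasurable.integral_prod_right'.aestronglyMeasurable
  refine ⟨(integrable_map_measure hm hX).1 hint'.integral_prod_left, ?_⟩
  calc _ = _ := hlXY.integral_comp hg.aestronglyMeasurable
    _ = _ := integral_prod _ hint'
    _ = _ := integral_map hX hm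

end Independence

section RelativeEntropy

lemma sub_lt_mul_log_div {p q : ℝ} (hp : 0 < p) (hq : 0 < q) (hpq : p ≠ q) :
    p - q < p * Real.log (p / q) := by
  have h := Real.log_lt_sub_one_of_pos (div_pos hq hp) fun h =>
    hpq ((div_eq_one_iff_eq hp.ne').1 h).symm
  rw [← inv_div q p, Real.log_inv]
  calc p - q = p * -(q / p - 1) := by field_simp; ring
    _ < _ := mul_lt_mul_of_pos_left (by linarith) hp

lemma sum_mul_log_div_pos {ι : Type*} [Fintype ι] {p q : ι → ℝ}
    (hpq : ∀ z, p z = q z ∨ (0 < p z ∧ 0 < q z)) (hsum : ∑ z, p z = ∑ z, q z) (hne : p ≠ q) :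
    0 < ∑ z, p z * Real.log (p z / q z) := by
  obtain ⟨z₀, hz₀⟩ := Function.ne_iff.1 hne
  have hlt (z) (hz : p z ≠ q z) : p z - q z < p z * Real.log (p z / q z) :=
    have hpos := (hpq z).resolve_left hz
    sub_lt_mul_log_div hpos.1 hpos.2 hz
  have hle (z) : p z - q z ≤ p z * Real.log (p z / q z) := by
    by_cases hz : p z = q z
    · rcases eq_or_ne (q z) 0 with h0 | h0 <;> simp [hz, h0]
    · exact (hlt z hz).le
  calc 0 = ∑ z, (p z - q z) := by rw [Finset.sum_sub_distrib, hsum, sub_self]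
    _ < _ := Finset.sum_lt_sum (fun z _ => hle z) ⟨z₀, Finset.mem_univ _, hlt z₀ hz₀⟩

end RelativeEntropy

section Belief

/-- A belief that gives positive probability to both qualities, so that its log-odds are finite. -/
def IsInteriorBelief (π : Quality → ℝ) : Prop := (∀ q, 0 < π q) ∧ π 0 + π 1 = 1

/-- The log-odds of high quality. -/
def logOdds (π : Quality → ℝ) : ℝ := Real.log (π 1 / π 0)

/-- The positive part of the log-odds of high quality, the potential that is tracked along the
learning process. -/
def optimism (π : Quality → ℝ) : ℝ := max (logOdds π) 0

/-- The belief that the quality is high with probability `x`. -/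
def beliefOf (x : ℝ) : Quality → ℝ := ![1 - x, x]

lemma beliefOf_mem_stdSimplex {x : ℝ} (h0 : 0 ≤ x) (h1 : x ≤ 1) :
    beliefOf x ∈ stdSimplex ℝ Quality :=
  ⟨fun q => by fin_cases q <;> simp [beliefOf, h0, h1], by simp [beliefOf]⟩

lemma optimism_nonneg (π : Quality → ℝ) : 0 ≤ optimism π := le_max_right _ _

lemma measurable_optimism : Measurable optimism := by
  unfold optimism logOdds
  fun_prop

lemma isInteriorBelief_prior : IsInteriorBelief prior := by
  norm_num [IsInteriorBelief, prior]

lemma optimism_prior : optimism prior = 0 := by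
  norm_num [optimism, logOdds, prior]

namespace IsInteriorBelief

variable {π : Quality → ℝ} (hπ : IsInteriorBelief π)
include hπ

lemma eq_beliefOf : π = beliefOf (π 1) := by
  ext q
  fin_cases q
  · simpa [beliefOf] using eq_sub_of_add_eq hπ.2
  · simp [beliefOf]

lemma mem_stdSimplex : π ∈ stdSimplex ℝ Quality :=
  ⟨fun q => (hπ.1 q).le, by rw [Fin.sum_univ_two, hπ.2]⟩

lemma le_one (q : Quality) : π q ≤ 1 :=
  (mem_Icc_of_mem_stdSimplex hπ.mem_stdSimplex q).2

lemma half_le_high (h : 0 ≤ logOdds π) : 1 / 2 ≤ π 1 := by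
  rw [logOdds, Real.log_nonneg_iff (div_pos (hπ.1 1) (hπ.1 0)), one_le_div (hπ.1 0)] at h
  linarith [hπ.2]

lemma half_le_low (h : logOdds π ≤ 0) : 1 / 2 ≤ π 0 := by
  rw [logOdds, Real.log_nonpos_iff (div_pos (hπ.1 1) (hπ.1 0)).le,
    div_le_one (hπ.1 0)] at h
  linarith [hπ.2]

end IsInteriorBelief

end Belief

section Feedback

variable {Θ E 𝓩 : Type*} {r : Quality → Θ → ℝ} {f : Quality → Θ → E → 𝓩}

lemma observation_eq_some_iff {π : Quality → ℝ} {q : Quality} {θ : Θ} {e : E} {z : 𝓩} :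
    observation r f π q θ e = some z ↔ 0 < expectedReward r π θ ∧ f q θ e = z := by
  unfold observation
  split_ifs with h <;> simp [h]

lemma observation_eq_none_iff {π : Quality → ℝ} {q : Quality} {θ : Θ} {e : E} :
    observation r f π q θ e = none ↔ ¬ 0 < expectedReward r π θ := by
  unfold observation
  split_ifs with h <;> simp [h]

lemma eventually_expectedReward_pos_iff (hcross : ∀ θ, 0 < r 0 θ → 0 < r 1 θ) (θ : Θ) :
    ∀ᶠ x in 𝓝[<] (1 : ℝ),
      (0 < expectedReward r (beliefOf x) θ ↔ 0 < expectedReward r (beliefOf 1) θ) := by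
  simp only [expectedReward, Fin.sum_univ_two, beliefOf, Matrix.cons_val_zero,
    Matrix.cons_val_one, sub_self, zero_mul, one_mul, zero_add]
  rcases lt_or_ge 0 (r 1 θ) with h | h
  · have hcont : Continuous fun x : ℝ => (1 - x) * r 0 θ + x * r 1 θ := by fun_prop
    have hpos : ∀ᶠ x in 𝓝 (1 : ℝ), 0 < (1 - x) * r 0 θ + x * r 1 θ :=
      hcont.tendsto 1 |>.eventually_const_lt (by simpa using h)
    filter_upwards [hpos.filter_mono nhdsWithin_le_nhds] with x hx
    exact iff_of_true hx h
  · have h₀ : r 0 θ ≤ 0 := not_lt.1 fun h₀ => (hcross θ h₀).not_ge h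
    filter_upwards [Ioo_mem_nhdsLT (one_pos (α := ℝ))] with x hx
    exact iff_of_false (not_lt.2 (add_nonpos
      (mul_nonpos_of_nonneg_of_nonpos (sub_nonneg.2 hx.2.le) h₀)
      (mul_nonpos_of_nonneg_of_nonpos hx.1.le h))) (not_lt.2 h)

local instance : MeasurableSpace (Option 𝓩) := ⊤

local instance : DiscreteMeasurableSpace (Option 𝓩) := ⟨fun _ => trivial⟩

variable [MeasurableSpace Θ] [MeasurableSpace E] {μΘ : Measure Θ} {μE : Measure E}

section Measurability

variable [Countable 𝓩] [MeasurableSpace 𝓩] [MeasurableSingletonClass 𝓩]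

lemma measurable_observation (hr : ∀ q, Measurable (r q))
    (hf : ∀ q, Measurable fun x : Θ × E => f q x.1 x.2) :
    Measurable fun y : ((Quality → ℝ) × Quality) × Θ × E =>
      observation r f y.1.1 y.1.2 y.2.1 y.2.2 := by
  have hreward : Measurable fun y : ((Quality → ℝ) × Quality) × Θ × E =>
      expectedReward r y.1.1 y.2.1 := by
    unfold expectedReward
    fun_prop
  have hreview : Measurable fun y : ((Quality → ℝ) × Quality) × Θ × E => f y.1.2 y.2.1 y.2.2 :=
    (measurable_from_prod_countable_right (f := fun y : Quality × Θ × E => f y.1 y.2.1 y.2.2)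
      hf).comp (measurable_fst.snd.prodMk measurable_snd)
  have hbuy := measurableSet_lt (measurable_const (a := (0 : ℝ))) hreward
  refine measurable_to_countable' fun z => ?_
  cases z with
  | none =>
    convert hbuy.compl using 1
    ext y
    exact observation_eq_none_iff
  | some z =>
    convert hbuy.inter (hreview (measurableSet_singleton z)) using 1
    ext y
    exact observation_eq_some_iff

lemma measurableSet_observation_eq (hr : ∀ q, Measurable (r q))
    (hf : ∀ q, Measurable fun x : Θ × E => f q x.1 x.2)
    (π : Quality → ℝ) (q : Quality) (z : Option 𝓩) :
    MeasurableSet {x : Θ × E | observation r f π q x.1 x.2 = z} :=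
  have h : Measurable fun x : Θ × E => observation r f π q x.1 x.2 :=
    (measurable_observation hr hf).comp (measurable_prodMk_left (x := (π, q)))
  h (measurableSet_singleton z)

lemma measurable_G [SFinite (μΘ.prod μE)] (hr : ∀ q, Measurable (r q))
    (hf : ∀ q, Measurable fun x : Θ × E => f q x.1 x.2) (z : Option 𝓩) :
    Measurable (Function.uncurry (G r f μΘ μE z)) := by
  have hset : MeasurableSet {y : ((Quality → ℝ) × Quality) × Θ × E |
      observation r f y.1.1 y.1.2 y.2.1 y.2.2 = z} :=
    have h := measurable_observation hr hf
    h (measurableSet_singleton z)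
  exact (measurable_measure_prodMk_left hset).ennreal_toReal

lemma measurable_stationaryUpdate [SFinite (μΘ.prod μE)] (hr : ∀ q, Measurable (r q))
    (hf : ∀ q, Measurable fun x : Θ × E => f q x.1 x.2) :
    Measurable fun y : Option 𝓩 × (Quality → ℝ) => stationaryUpdate r f μΘ μE y.1 y.2 := by
  refine measurable_from_prod_countable_right fun z => measurable_pi_lambda _ fun q => ?_
  have hG (q : Quality) : Measurable fun π : Quality → ℝ => G r f μΘ μE z π q :=
    (measurable_G hr hf z).of_uncurry_right
  simp only [stationaryUpdate, Gavg]
  fun_prop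

end Measurability

lemma G_nonneg (z : Option 𝓩) (π : Quality → ℝ) (q : Quality) : 0 ≤ G r f μΘ μE z π q :=
  measureReal_nonneg

lemma G_none_eq (π : Quality → ℝ) (q q' : Quality) :
    G r f μΘ μE none π q = G r f μΘ μE none π q' := by
  simp only [G, observation_eq_none_iff]

section Update

variable {π : Quality → ℝ} {z : Option 𝓩}

lemma Gavg_pos (hπ : IsInteriorBelief π) (hz : ∀ q, 0 < G r f μΘ μE z π q) :
    0 < Gavg r f μΘ μE z π :=
  Finset.sum_pos (fun q _ => mul_pos (hπ.1 q) (hz q)) Finset.univ_nonempty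

lemma IsInteriorBelief.stationaryUpdate (hπ : IsInteriorBelief π)
    (hz : ∀ q, 0 < G r f μΘ μE z π q) : IsInteriorBelief (stationaryUpdate r f μΘ μE z π) := by
  have hg := Gavg_pos hπ hz
  refine ⟨fun q => mul_pos (div_pos (hz q) hg) (hπ.1 q), ?_⟩
  simp only [SocialLearning.stationaryUpdate]
  field_simp
  rw [Gavg, Fin.sum_univ_two]
  ring

lemma logOdds_stationaryUpdate (hπ : IsInteriorBelief π) (hz : ∀ q, 0 < G r f μΘ μE z π q) :
    logOdds (stationaryUpdate r f μΘ μE z π) =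
      logOdds π + Real.log (G r f μΘ μE z π 1 / G r f μΘ μE z π 0) := by
  have hg := Gavg_pos hπ hz
  have hπ₀ := hπ.1 0
  have hz₀ := hz 0
  rw [logOdds, logOdds, ← Real.log_mul (div_pos (hπ.1 1) hπ₀).ne' (div_pos (hz 1) hz₀).ne']
  simp only [stationaryUpdate]
  congr 1
  field_simp

end Update

lemma Identifiable.G_some_pos (hident : Identifiable r f μΘ μE) {π : Quality → ℝ}
    (hπ : π ∈ stdSimplex ℝ Quality) (z : 𝓩) (q : Quality) : 0 < G r f μΘ μE (some z) π q :=
  have ⟨q', hq⟩ := exists_ne q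
  (hident π hπ q q' hq.symm).1 z

lemma Identifiable.G_pos (hident : Identifiable r f μΘ μE) {π : Quality → ℝ}
    (hπ : π ∈ stdSimplex ℝ Quality) {z : Option 𝓩} {q : Quality} (hz : 0 < G r f μΘ μE z π q)
    (q' : Quality) : 0 < G r f μΘ μE z π q' := by
  cases z with
  | none => rwa [G_none_eq π q' q]
  | some z => exact hident.G_some_pos hπ z q'

lemma Identifiable.abs_optimism_stationaryUpdate_sub_le (hident : Identifiable r f μΘ μE)
    {π : Quality → ℝ} (hπ : IsInteriorBelief π) {z : Option 𝓩} {q : Quality}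
    (hz : 0 < G r f μΘ μE z π q) :
    |optimism (stationaryUpdate r f μΘ μE z π) - optimism π| ≤
      |Real.log (G r f μΘ μE z π 1 / G r f μΘ μE z π 0)| := by
  refine (abs_max_sub_max_le_abs _ _ _).trans_eq ?_
  rw [logOdds_stationaryUpdate hπ (hident.G_pos hπ.mem_stdSimplex hz), add_sub_cancel_left]

/-- Those who buy under the worst belief buy under every belief. -/
lemma G_some_beliefOf_zero_le [IsFiniteMeasure (μΘ.prod μE)]
    (hcross : ∀ θ, 0 < r 0 θ → 0 < r 1 θ) {π : Quality → ℝ} (hπ : IsInteriorBelief π)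
    (z : 𝓩) (q : Quality) :
    G r f μΘ μE (some z) (beliefOf 0) q ≤ G r f μΘ μE (some z) π q := by
  refine measureReal_mono fun x hx => ?_
  simp only [Set.mem_ofPred_eq, observation_eq_some_iff, expectedReward, Fin.sum_univ_two,
    beliefOf, Matrix.cons_val_zero, Matrix.cons_val_one, sub_zero, one_mul, zero_mul,
    add_zero] at hx ⊢
  exact ⟨add_pos (mul_pos (hπ.1 0) hx.1) (mul_pos (hπ.1 1) (hcross x.1 hx.1)), hx.2⟩

lemma tendsto_G_some_one [Countable 𝓩] [MeasurableSpace 𝓩] [MeasurableSingletonClass 𝓩]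
    [IsFiniteMeasure (μΘ.prod μE)] (hr : ∀ q, Measurable (r q))
    (hf : ∀ q, Measurable fun x : Θ × E => f q x.1 x.2)
    (hcross : ∀ θ, 0 < r 0 θ → 0 < r 1 θ) (z : 𝓩) (q : Quality) :
    Tendsto (fun x => G r f μΘ μE (some z) (beliefOf x) q) (𝓝[<] 1)
      (𝓝 (G r f μΘ μE (some z) (beliefOf 1) q)) := by
  refine (ENNReal.tendsto_toReal (measure_ne_top _ _)).comp
    (tendsto_measure_of_tendsto_indicator_of_isFiniteMeasure _ _
      (fun x => measurableSet_observation_eq hr hf _ q _) fun y => ?_)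
  filter_upwards [eventually_expectedReward_pos_iff hcross y.1] with x hx
  simp only [observation_eq_some_iff, hx]

section Drift

variable [IsProbabilityMeasure μΘ] [IsProbabilityMeasure μE]

lemma G_le_one (z : Option 𝓩) (π : Quality → ℝ) (q : Quality) : G r f μΘ μE z π q ≤ 1 :=
  measureReal_le_one

lemma exists_abs_log_G_div_le [Finite 𝓩] (hcross : ∀ θ, 0 < r 0 θ → 0 < r 1 θ)
    (hident : Identifiable r f μΘ μE) :
    ∃ M, ∀ π, IsInteriorBelief π → ∀ z,
      |Real.log (G r f μΘ μE z π 1 / G r f μΘ μE z π 0)| ≤ M := by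
  have hworst := beliefOf_mem_stdSimplex le_rfl zero_le_one
  have : Nonempty 𝓩 := ⟨(hident _ hworst 0 1 (by decide)).2.choose⟩
  obtain ⟨⟨z₀, q₀⟩, hmin⟩ := Finite.exists_min fun y : 𝓩 × Quality =>
    G r f μΘ μE (some y.1) (beliefOf 0) y.2
  set g := G r f μΘ μE (some z₀) (beliefOf 0) q₀
  have hg : 0 < g := hident.G_some_pos hworst z₀ q₀
  refine ⟨-Real.log g, fun π hπ z => ?_⟩
  rcases z with _ | z
  · rw [G_none_eq π 1 0]
    have : Real.log g ≤ 0 := Real.log_nonpos hg.le (G_le_one _ _ _)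
    rcases eq_or_ne (G r f μΘ μE none π 0) 0 with h | h <;> simpa [h]
  · have hpos := hident.G_some_pos hπ.mem_stdSimplex z
    have hlower (q : Quality) : Real.log g ≤ Real.log (G r f μΘ μE (some z) π q) :=
      Real.log_le_log hg ((hmin (z, q)).trans (G_some_beliefOf_zero_le hcross hπ z q))
    have hupper (q : Quality) : Real.log (G r f μΘ μE (some z) π q) ≤ 0 :=
      Real.log_nonpos (hpos q).le (G_le_one _ _ _)
    rw [Real.log_div (hpos 1).ne' (hpos 0).ne', abs_le]
    constructor <;> linarith [hlower 0, hlower 1, hupper 0, hupper 1]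

variable [Fintype 𝓩]

/-- The drift of the log-odds under high quality, with belief `π`. It is the relative entropy of
the observation under high quality with respect to the observation under low quality. -/
def drift (r : Quality → Θ → ℝ) (f : Quality → Θ → E → 𝓩) (μΘ : Measure Θ) (μE : Measure E)
    (π : Quality → ℝ) : ℝ :=
  ∑ z, G r f μΘ μE z π 1 * Real.log (G r f μΘ μE z π 1 / G r f μΘ μE z π 0)

variable [MeasurableSpace 𝓩] [MeasurableSingletonClass 𝓩]

lemma sum_G (hr : ∀ q, Measurable (r q)) (hf : ∀ q, Measurable fun x : Θ × E => f q x.1 x.2)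
    (π : Quality → ℝ) (q : Quality) : ∑ z, G r f μΘ μE z π q = 1 := by
  have h := sum_measureReal_preimage_singleton (μ := μΘ.prod μE) Finset.univ
    (f := fun x : Θ × E => observation r f π q x.1 x.2)
    fun z _ => measurableSet_observation_eq hr hf π q z
  rwa [Finset.coe_univ, Set.preimage_univ, probReal_univ] at h

lemma Identifiable.drift_pos (hident : Identifiable r f μΘ μE) (hr : ∀ q, Measurable (r q))
    (hf : ∀ q, Measurable fun x : Θ × E => f q x.1 x.2)
    {π : Quality → ℝ} (hπ : π ∈ stdSimplex ℝ Quality) : 0 < drift r f μΘ μE π := by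
  refine sum_mul_log_div_pos (fun z => ?_) (by rw [sum_G hr hf, sum_G hr hf]) fun h => ?_
  · cases z with
    | none => exact Or.inl (G_none_eq π 1 0)
    | some z => exact Or.inr ⟨hident.G_some_pos hπ z 1, hident.G_some_pos hπ z 0⟩
  · obtain ⟨z, hz⟩ := (hident π hπ 1 0 (by decide)).2
    exact hz (congrFun h (some z))

lemma Identifiable.tendsto_drift_one (hident : Identifiable r f μΘ μE)
    (hr : ∀ q, Measurable (r q)) (hf : ∀ q, Measurable fun x : Θ × E => f q x.1 x.2)
    (hcross : ∀ θ, 0 < r 0 θ → 0 < r 1 θ) :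
    Tendsto (fun x => drift r f μΘ μE (beliefOf x)) (𝓝[<] 1)
      (𝓝 (drift r f μΘ μE (beliefOf 1))) := by
  refine tendsto_finsetSum _ fun z _ => ?_
  cases z with
  | none =>
    have hnone (π : Quality → ℝ) : G r f μΘ μE none π 1 *
        Real.log (G r f μΘ μE none π 1 / G r f μΘ μE none π 0) = 0 := by
      rw [G_none_eq π 1 0]
      rcases eq_or_ne (G r f μΘ μE none π 0) 0 with h | h <;> simp [h]
    simp only [hnone, tendsto_const_nhds]
  | some z =>
    have hpos := hident.G_some_pos (beliefOf_mem_stdSimplex zero_le_one le_rfl) z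
    have hlim := tendsto_G_some_one (μΘ := μΘ) (μE := μE) hr hf hcross z
    exact (hlim 1).mul
      (((hlim 1).div (hlim 0) (hpos 0).ne').log (div_pos (hpos 1) (hpos 0)).ne')

lemma Identifiable.exists_le_drift_add (hident : Identifiable r f μΘ μE)
    (hr : ∀ q, Measurable (r q)) (hf : ∀ q, Measurable fun x : Θ × E => f q x.1 x.2)
    (hcross : ∀ θ, 0 < r 0 θ → 0 < r 1 θ) :
    ∃ k > 0, ∃ C ≥ 0, ∀ π, IsInteriorBelief π → k ≤ drift r f μΘ μE π + C * (1 - π 1) := by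
  have hone := hident.drift_pos hr hf (beliefOf_mem_stdSimplex zero_le_one le_rfl)
  set k := drift r f μΘ μE (beliefOf 1) / 2
  have hk₀ : 0 < k := half_pos hone
  obtain ⟨x₀, hx₀, hx⟩ := (mem_nhdsLT_iff_exists_Ioo_subset' (zero_lt_one (α := ℝ))).1
    ((hident.tendsto_drift_one hr hf hcross).eventually_const_le (half_lt_self hone))
  have hx₀' : 0 < 1 - x₀ := sub_pos.2 hx₀
  refine ⟨k, hk₀, k / (1 - x₀), by positivity, fun π hπ => ?_⟩
  have hlt : π 1 < 1 := by linarith [hπ.1 0, hπ.2]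
  rcases lt_or_ge x₀ (π 1) with h | h
  · have hdrift : k ≤ drift r f μΘ μE π := by
      rw [hπ.eq_beliefOf]
      exact hx ⟨h, hlt⟩
    have : 0 ≤ 1 - π 1 := by linarith
    linarith [(by positivity : 0 ≤ k / (1 - x₀) * (1 - π 1))]
  · have hloss : k ≤ k / (1 - x₀) * (1 - π 1) := by
      rw [div_mul_eq_mul_div, le_div_iff₀ hx₀']
      gcongr
    linarith [hident.drift_pos hr hf hπ.mem_stdSimplex]

/-- A Foster-Lyapunov condition for `optimism`: its jumps are bounded above by `C`, and at the price
of `C` times the expected loss it does not decrease on average and, under high quality, it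
increases by `k` on average. -/
structure HasOptimismDrift (r : Quality → Θ → ℝ) (f : Quality → Θ → E → 𝓩) (μΘ : Measure Θ)
    (μE : Measure E) (k C : ℝ) : Prop where
  pos : 0 < k
  le : k ≤ C
  optimism_stationaryUpdate_le : ∀ π, IsInteriorBelief π → ∀ z q, 0 < G r f μΘ μE z π q →
    optimism (stationaryUpdate r f μΘ μE z π) ≤ optimism π + C
  add_le_sum : ∀ π, IsInteriorBelief π → ∀ q, optimism π + (if q = 1 then k else 0) ≤
    ∑ z, G r f μΘ μE z π q * optimism (stationaryUpdate r f μΘ μE z π) + C * (1 - π q)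

lemma Identifiable.logOdds_add_drift_le_sum (hident : Identifiable r f μΘ μE)
    (hr : ∀ q, Measurable (r q)) (hf : ∀ q, Measurable fun x : Θ × E => f q x.1 x.2)
    {π : Quality → ℝ} (hπ : IsInteriorBelief π) :
    logOdds π + drift r f μΘ μE π ≤
      ∑ z, G r f μΘ μE z π 1 * optimism (stationaryUpdate r f μΘ μE z π) := by
  rw [drift, ← one_mul (logOdds π), ← sum_G hr hf π 1 (μΘ := μΘ) (μE := μE), Finset.sum_mul,
    ← Finset.sum_add_distrib]
  refine Finset.sum_le_sum fun z _ => ?_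
  rcases (G_nonneg (r := r) (f := f) (μΘ := μΘ) (μE := μE) z π 1).eq_or_lt with h | h
  · simp [← h]
  · rw [← mul_add, ← logOdds_stationaryUpdate hπ (hident.G_pos hπ.mem_stdSimplex h)]
    exact mul_le_mul_of_nonneg_left (le_max_left _ _) h.le

lemma Identifiable.optimism_sub_le_sum (hident : Identifiable r f μΘ μE)
    (hr : ∀ q, Measurable (r q)) (hf : ∀ q, Measurable fun x : Θ × E => f q x.1 x.2)
    {π : Quality → ℝ} (hπ : IsInteriorBelief π) {M : ℝ}
    (hM : ∀ z, |Real.log (G r f μΘ μE z π 1 / G r f μΘ μE z π 0)| ≤ M) (q : Quality) :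
    optimism π - M ≤ ∑ z, G r f μΘ μE z π q * optimism (stationaryUpdate r f μΘ μE z π) := by
  rw [← one_mul (optimism π - M), ← sum_G hr hf π q (μΘ := μΘ) (μE := μE), Finset.sum_mul]
  refine Finset.sum_le_sum fun z _ => ?_
  rcases (G_nonneg (r := r) (f := f) (μΘ := μΘ) (μE := μE) z π q).eq_or_lt with h | h
  · simp [← h]
  · have hjump := (hident.abs_optimism_stationaryUpdate_sub_le hπ h).trans (hM z)
    exact mul_le_mul_of_nonneg_left (by linarith [(abs_le.1 hjump).1]) h.le

lemma Identifiable.exists_hasOptimismDrift (hident : Identifiable r f μΘ μE)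
    (hr : ∀ q, Measurable (r q)) (hf : ∀ q, Measurable fun x : Θ × E => f q x.1 x.2)
    (hcross : ∀ θ, 0 < r 0 θ → 0 < r 1 θ) : ∃ k C, HasOptimismDrift r f μΘ μE k C := by
  obtain ⟨M, hM⟩ := exists_abs_log_G_div_le hcross hident
  obtain ⟨k, hk, C₀, hC₀, hdrift⟩ := hident.exists_le_drift_add hr hf hcross
  have hM₀ : 0 ≤ M := (abs_nonneg _).trans (hM prior isInteriorBelief_prior none)
  set C := C₀ + 2 * k + 2 * M
  refine ⟨k, C, hk, by linarith, fun π hπ z q hz => ?_, fun π hπ => ?_⟩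
  · have hjump := (hident.abs_optimism_stationaryUpdate_sub_le hπ hz).trans (hM π hπ z)
    linarith [(abs_le.1 hjump).2]
  have hsum (q) : 0 ≤ ∑ z, G r f μΘ μE z π q * optimism (stationaryUpdate r f μΘ μE z π) :=
    Finset.sum_nonneg fun z _ => mul_nonneg (G_nonneg z π q) (optimism_nonneg _)
  have hloss (q) : 0 ≤ 1 - π q := sub_nonneg.2 (hπ.le_one q)
  have hC₀C : C₀ * (1 - π 1) ≤ C * (1 - π 1) := by gcongr; exacts [hloss 1, by linarith]
  have hcost {q} (hq : 1 / 2 ≤ 1 - π q) : C * (1 / 2) ≤ C * (1 - π q) := by gcongr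
  rw [Fin.forall_fin_two, if_neg (by decide), if_pos rfl]
  rcases le_total (logOdds π) 0 with hℓ | hℓ
  · rw [optimism, max_eq_right hℓ]
    have hwrong : 1 / 2 ≤ 1 - π 1 := by linarith [hπ.half_le_low hℓ, hπ.2]
    exact ⟨by linarith [hsum 0, mul_nonneg (by positivity : 0 ≤ C) (hloss 0)],
      by linarith [hsum 1, hcost hwrong]⟩
  · have hwrong : 1 / 2 ≤ 1 - π 0 := by linarith [hπ.half_le_high hℓ, hπ.2]
    have hopt : optimism π = logOdds π := max_eq_left hℓ
    exact ⟨by linarith [hident.optimism_sub_le_sum hr hf hπ (hM π hπ) 0, hcost hwrong],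
      by linarith [hident.logOdds_add_drift_le_sum hr hf hπ, hdrift π hπ]⟩

end Drift

section Transition

/-- The public belief together with the current quality. -/
abbrev MarketState : Type := (Quality → ℝ) × Quality

/-- The change of state caused by the fresh draw and the coin `y.2`. -/
def redraw (y : MarketState × Quality × Bool) : MarketState :=
  (y.1.1, if y.2.2 then y.2.1 else y.1.2)

/-- The law of a coin that shows `true` with probability `η`. -/
def coinLaw (η : ℝ) : Measure Bool :=
  ENNReal.ofReal η • Measure.dirac true + ENNReal.ofReal (1 - η) • Measure.dirac false

instance (η : ℝ) : SFinite (coinLaw η) := by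
  unfold coinLaw
  infer_instance

/-- The joint law of a fresh draw and an independent coin. -/
def redrawLaw (η : ℝ) : Measure (Quality × Bool) :=
  (uniformOn (Set.univ : Set Quality)).prod (coinLaw η)

/-- The conditional expectation of `g` after a redraw from the state `s`. -/
def redrawMean (η : ℝ) (g : MarketState → ℝ) (s : MarketState) : ℝ :=
  (1 - η) * g s + η / 2 * ∑ q, g (s.1, q)

/-- The change of state caused by a consumer with preference and noise `y.2`. -/
def learn (r : Quality → Θ → ℝ) (f : Quality → Θ → E → 𝓩) (μΘ : Measure Θ) (μE : Measure E)
    (y : MarketState × Θ × E) : MarketState :=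
  (stationaryUpdate r f μΘ μE (observation r f y.1.1 y.1.2 y.2.1 y.2.2) y.1.1, y.1.2)

/-- The conditional expectation of `g` after a consumer has arrived in the state `s`. -/
def learnMean [Fintype 𝓩] (r : Quality → Θ → ℝ) (f : Quality → Θ → E → 𝓩) (μΘ : Measure Θ)
    (μE : Measure E) (g : MarketState → ℝ) (s : MarketState) : ℝ :=
  ∑ z, G r f μΘ μE z s.1 s.2 * g (stationaryUpdate r f μΘ μE z s.1, s.2)

lemma measurable_redraw : Measurable redraw :=
  measurable_fst.fst.prodMk <|
    .ite (measurable_snd.snd (measurableSet_singleton true)) measurable_snd.fst measurable_fst.snd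

instance : IsProbabilityMeasure (uniformOn (Set.univ : Set Quality)) :=
  isProbabilityMeasure_uniformOn Set.finite_univ Set.univ_nonempty

instance (η : ℝ) : SFinite (redrawLaw η) := by
  unfold redrawLaw
  infer_instance

lemma mem_Icc_of_isProbabilityMeasure_redrawLaw {η : ℝ} [IsProbabilityMeasure (redrawLaw η)] :
    η ∈ Set.Icc 0 1 := by
  have hmass : ENNReal.ofReal η + ENNReal.ofReal (1 - η) = 1 := by
    simpa [redrawLaw, coinLaw, ← Set.univ_prod_univ] using measure_univ (μ := redrawLaw η)
  refine ⟨not_lt.1 fun h => ?_, not_lt.1 fun h => ?_⟩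
  · rw [ENNReal.ofReal_of_nonpos h.le, zero_add, ENNReal.ofReal_eq_one] at hmass
    linarith
  · rw [ENNReal.ofReal_of_nonpos (sub_nonpos.2 h.le), add_zero, ENNReal.ofReal_eq_one] at hmass
    linarith

lemma uniformOn_univ_real_singleton (q : Quality) :
    (uniformOn (Set.univ : Set Quality)).real {q} = 1 / 2 := by
  simp [measureReal_def, uniformOn_univ]

lemma integral_redraw {η : ℝ} [IsProbabilityMeasure (redrawLaw η)] (g : MarketState → ℝ)
    (s : MarketState) : ∫ u, g (redraw (s, u)) ∂redrawLaw η = redrawMean η g s := by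
  have hη := mem_Icc_of_isProbabilityMeasure_redrawLaw (η := η)
  have hmass (q : Quality) (b : Bool) : (redrawLaw η).real {(q, b)} =
      1 / 2 * if b then η else 1 - η := by
    rw [← Set.singleton_prod_singleton, redrawLaw, measureReal_prod_prod,
      uniformOn_univ_real_singleton]
    congr 1
    cases b <;> simp [coinLaw, measureReal_def, hη.1, hη.2]
  rw [integral_fintype .of_finite, Fintype.sum_prod_type]
  simp only [Fin.sum_univ_two, Fintype.sum_bool, hmass, smul_eq_mul, redraw, redrawMean, if_true,
    Bool.false_eq_true, if_false]
  ring

variable [MeasurableSpace 𝓩] [MeasurableSingletonClass 𝓩]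

lemma measurable_learn [Countable 𝓩] [SFinite (μΘ.prod μE)] (hr : ∀ q, Measurable (r q))
    (hf : ∀ q, Measurable fun x : Θ × E => f q x.1 x.2) : Measurable (learn r f μΘ μE) :=
  have hupdate := measurable_stationaryUpdate (μΘ := μΘ) (μE := μE) hr hf
  (hupdate.comp ((measurable_observation hr hf).prodMk measurable_fst.fst)).prodMk
    measurable_fst.snd

lemma integral_learn [Fintype 𝓩] [IsFiniteMeasure (μΘ.prod μE)] (hr : ∀ q, Measurable (r q))
    (hf : ∀ q, Measurable fun x : Θ × E => f q x.1 x.2) (g : MarketState → ℝ) (s : MarketState) :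
    ∫ x, g (learn r f μΘ μE (s, x)) ∂(μΘ.prod μE) = learnMean r f μΘ μE g s := by
  set obs : Θ × E → Option 𝓩 := fun x => observation r f s.1 s.2 x.1 x.2
  have hobs : Measurable obs := (measurable_observation hr hf).comp measurable_prodMk_left
  set h : Option 𝓩 → ℝ := fun z => g (stationaryUpdate r f μΘ μE z s.1, s.2)
  calc _ = ∫ z, h z ∂(μΘ.prod μE).map obs :=
        (integral_map hobs.aemeasurable measurable_from_top.aestronglyMeasurable).symm
    _ = ∑ z, ((μΘ.prod μE).map obs).real {z} * h z := integral_fintype .of_finite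
    _ = _ := ?_
  refine Finset.sum_congr rfl fun z _ => ?_
  rw [map_measureReal_apply hobs (measurableSet_singleton z)]
  rfl

end Transition

section Chain

variable {Ω : Type*} [MeasurableSpace Ω]

/-- The Markov chain of the market states. In period `t` the state `start t` is turned into
`arrival t` by a redraw of the quality, and then into `start (t + 1)` by consumer `t + 1`. -/
structure IsMarketChain (r : Quality → Θ → ℝ) (f : Quality → Θ → E → 𝓩) (μΘ : Measure Θ)
    (μE : Measure E) (η : ℝ) (P : Measure Ω) (start arrival : ℕ → Ω → MarketState) : Prop where
  measurable_start : ∀ t, Measurable (start t)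
  measurable_arrival : ∀ t, Measurable (arrival t)
  belief_zero : ∀ ω, (start 0 ω).1 = prior
  hasLaw_quality_zero : HasLaw (fun ω => (start 0 ω).2) (uniformOn Set.univ) P
  arrival_eq : ∀ t, ∃ u, HasLaw u (redrawLaw η) P ∧ IndepFun (start t) u P ∧
    ∀ ω, arrival t ω = redraw (start t ω, u ω)
  start_succ_eq : ∀ t, ∃ x, HasLaw x (μΘ.prod μE) P ∧ IndepFun (arrival t) x P ∧
    ∀ ω, start (t + 1) ω = learn r f μΘ μE (arrival t ω, x ω)

lemma measurableSet_isInteriorBelief : MeasurableSet {π : Quality → ℝ | IsInteriorBelief π} := by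
  unfold IsInteriorBelief
  measurability

/-- `optimism`, weighted by a function of the quality. -/
def weightedOptimism (w : Quality → ℝ) (s : MarketState) : ℝ := w s.2 * optimism s.1

/-- The expected probability that the belief gives to the wrong quality when consumer `t + 1`
arrives. -/
def meanLoss (P : Measure Ω) (arrival : ℕ → Ω → MarketState) (t : ℕ) : ℝ :=
  ∫ ω, (1 - (arrival t ω).1 (arrival t ω).2) ∂P

lemma measurable_weightedOptimism (w : Quality → ℝ) : Measurable (weightedOptimism w) :=
  ((measurable_of_finite w).comp measurable_snd).mul (measurable_optimism.comp measurable_fst)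

lemma integrable_weightedOptimism {P : Measure Ω} [IsFiniteMeasure P] {s : Ω → MarketState}
    (hs : Measurable s) {b : ℝ} (hb : ∀ᵐ ω ∂P, optimism (s ω).1 ≤ b) (w : Quality → ℝ) :
    Integrable (fun ω => weightedOptimism w (s ω)) P := by
  refine .of_bound ((measurable_weightedOptimism w).comp hs).aestronglyMeasurable
    ((|w 0| + |w 1|) * b) ?_
  filter_upwards [hb] with ω hω
  have hw : |w (s ω).2| ≤ |w 0| + |w 1| := by
    rw [← Fin.sum_univ_two fun q => |w q|]
    exact Finset.single_le_sum (f := fun q => |w q|) (fun q _ => abs_nonneg _) (Finset.mem_univ _)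
  rw [weightedOptimism, norm_mul, Real.norm_eq_abs, Real.norm_of_nonneg (optimism_nonneg _)]
  exact mul_le_mul hw hω (optimism_nonneg _) (by positivity)

lemma integrable_loss {P : Measure Ω} [IsFiniteMeasure P] {s : Ω → MarketState} (hs : Measurable s)
    (hint : ∀ᵐ ω ∂P, IsInteriorBelief (s ω).1) :
    Integrable (fun ω => 1 - (s ω).1 (s ω).2) P := by
  have heval : Measurable fun s : MarketState => s.1 s.2 :=
    measurable_from_prod_countable_left fun q => measurable_pi_apply q
  refine .of_bound (measurable_const.sub (heval.comp hs)).aestronglyMeasurable 1 ?_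
  filter_upwards [hint] with ω hω
  rw [Real.norm_eq_abs, abs_le]
  constructor <;> linarith [hω.1 (s ω).2, hω.le_one (s ω).2]

/-- A belief with positive optimism gives low quality at most probability `1 / 2`. -/
lemma weightedOptimism_low_le {s : MarketState} (hs : IsInteriorBelief s.1) {b : ℝ}
    (hb : optimism s.1 ≤ b) : weightedOptimism ![1, 0] s ≤ 2 * b * (1 - s.1 s.2) := by
  obtain ⟨π, q⟩ := s
  dsimp only at hs hb ⊢
  have hb₀ : 0 ≤ b := (optimism_nonneg π).trans hb
  have hloss : 0 ≤ 1 - π q := sub_nonneg.2 (hs.le_one q)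
  rcases Fin.exists_fin_two.1 ⟨q, rfl⟩ with rfl | rfl
  · rcases le_total (logOdds π) 0 with hℓ | hℓ
    · rw [weightedOptimism, optimism, max_eq_right hℓ, mul_zero]
      positivity
    · have hhalf : 1 / 2 ≤ 1 - π 0 := by linarith [hs.half_le_high hℓ, hs.2]
      calc weightedOptimism ![1, 0] (π, 0) = optimism π := by simp [weightedOptimism]
        _ ≤ 2 * b * (1 / 2) := by linarith
        _ ≤ 2 * b * (1 - π 0) := by gcongr
  · simp only [weightedOptimism, Matrix.cons_val_one, Matrix.cons_val_fin_one, zero_mul]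
    positivity

lemma HasOptimismDrift.weightedOptimism_add_le [Fintype 𝓩] {k C : ℝ}
    (hdrift : HasOptimismDrift r f μΘ μE k C) {w : Quality → ℝ} (hw : ∀ q, w q ∈ Set.Icc 0 1)
    {s : MarketState} (hs : IsInteriorBelief s.1) :
    weightedOptimism w s + w s.2 * (if s.2 = 1 then k else 0) ≤
      learnMean r f μΘ μE (weightedOptimism w) s + C * (1 - s.1 s.2) := by
  obtain ⟨π, q⟩ := s
  have hstep := mul_le_mul_of_nonneg_left (hdrift.add_le_sum π hs q) (hw q).1
  have hloss : w q * (C * (1 - π q)) ≤ C * (1 - π q) :=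
    mul_le_of_le_one_left (mul_nonneg (hdrift.pos.le.trans hdrift.le)
      (sub_nonneg.2 (hs.le_one q))) (hw q).2
  simp only [learnMean, weightedOptimism, mul_left_comm _ (w q), ← Finset.mul_sum]
  linarith

namespace IsMarketChain

variable {η k C : ℝ} {P : Measure Ω} {start arrival : ℕ → Ω → MarketState}

lemma belief_arrival (h : IsMarketChain r f μΘ μE η P start arrival) (t : ℕ) (ω : Ω) :
    (arrival t ω).1 = (start t ω).1 := by
  obtain ⟨u, -, -, hu⟩ := h.arrival_eq t
  rw [hu]
  rfl

lemma quality_start_succ (h : IsMarketChain r f μΘ μE η P start arrival) (t : ℕ) (ω : Ω) :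
    (start (t + 1) ω).2 = (arrival t ω).2 := by
  obtain ⟨x, -, -, hx⟩ := h.start_succ_eq t
  rw [hx]
  rfl

variable [IsProbabilityMeasure P]

lemma redraw_prob_mem_Icc (h : IsMarketChain r f μΘ μE η P start arrival) : η ∈ Set.Icc 0 1 := by
  obtain ⟨u, hu, -, -⟩ := h.arrival_eq 0
  have := hu.isProbabilityMeasure_iff.1 inferInstance
  exact mem_Icc_of_isProbabilityMeasure_redrawLaw

lemma integral_arrival (h : IsMarketChain r f μΘ μE η P start arrival) {g : MarketState → ℝ}
    (hg : Measurable g) {t : ℕ} (hint : Integrable (fun ω => g (arrival t ω)) P) :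
    ∫ ω, g (arrival t ω) ∂P = ∫ ω, redrawMean η g (start t ω) ∂P := by
  obtain ⟨u, hlaw, hind, hu⟩ := h.arrival_eq t
  have := hlaw.isProbabilityMeasure_iff.1 inferInstance
  simp only [hu] at hint ⊢
  have hmean := (integral_prodMk_of_indepFun (h.measurable_start t).aemeasurable hlaw hind
    (hg.comp measurable_redraw) hint).2
  simpa only [Function.comp_apply, integral_redraw] using hmean

lemma integral_quality_start (h : IsMarketChain r f μΘ μE η P start arrival) (t : ℕ)
    (w : Quality → ℝ) : ∫ ω, w (start t ω).2 ∂P = (w 0 + w 1) / 2 := by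
  induction t with
  | zero =>
    have hlaw := h.hasLaw_quality_zero.integral_comp (measurable_of_finite w).aestronglyMeasurable
    refine hlaw.trans ?_
    rw [integral_fintype .of_finite]
    simp only [uniformOn_univ_real_singleton, Fin.sum_univ_two, smul_eq_mul]
    ring
  | succ t ih =>
    have hw : Measurable fun s : MarketState => w s.2 :=
      (measurable_of_finite w).comp measurable_snd
    have hint (s : Ω → MarketState) (hs : Measurable s) : Integrable (fun ω => w (s ω).2) P :=
      (Integrable.of_finite (μ := P.map fun ω => (s ω).2)).comp_measurable hs.snd
    simp only [h.quality_start_succ]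
    rw [h.integral_arrival hw (hint _ (h.measurable_arrival t))]
    simp only [redrawMean, Fin.sum_univ_two]
    rw [integral_add ((hint _ (h.measurable_start t)).const_mul _) (integrable_const _),
      integral_const_mul, ih, integral_const, probReal_univ, one_smul]
    ring

lemma meanLoss_zero (h : IsMarketChain r f μΘ μE η P start arrival) :
    meanLoss P arrival 0 = 1 / 2 := by
  simp only [meanLoss, h.belief_arrival, h.belief_zero, prior, integral_const, probReal_univ]
  norm_num

variable [IsProbabilityMeasure μΘ] [IsProbabilityMeasure μE]
  [Fintype 𝓩] [MeasurableSpace 𝓩] [MeasurableSingletonClass 𝓩]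

lemma integral_start_succ (h : IsMarketChain r f μΘ μE η P start arrival)
    (hr : ∀ q, Measurable (r q)) (hf : ∀ q, Measurable fun x : Θ × E => f q x.1 x.2)
    {g : MarketState → ℝ} (hg : Measurable g) {t : ℕ}
    (hint : Integrable (fun ω => g (start (t + 1) ω)) P) :
    Integrable (fun ω => learnMean r f μΘ μE g (arrival t ω)) P ∧
      ∫ ω, g (start (t + 1) ω) ∂P = ∫ ω, learnMean r f μΘ μE g (arrival t ω) ∂P := by
  obtain ⟨x, hlaw, hind, hx⟩ := h.start_succ_eq t
  simp only [hx] at hint ⊢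
  have hmean := integral_prodMk_of_indepFun (h.measurable_arrival t).aemeasurable hlaw hind
    (hg.comp (measurable_learn hr hf)) hint
  simpa only [Function.comp_apply, integral_learn hr hf] using hmean

lemma ae_optimism_start_le (h : IsMarketChain r f μΘ μE η P start arrival)
    (hr : ∀ q, Measurable (r q)) (hf : ∀ q, Measurable fun x : Θ × E => f q x.1 x.2)
    (hident : Identifiable r f μΘ μE) (hdrift : HasOptimismDrift r f μΘ μE k C) (t : ℕ) :
    ∀ᵐ ω ∂P, IsInteriorBelief (start t ω).1 ∧ optimism (start t ω).1 ≤ C * t := by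
  induction t with
  | zero => simp [h.belief_zero, isInteriorBelief_prior, optimism_prior]
  | succ t ih =>
    set bad : Set MarketState := {s | ¬ (IsInteriorBelief s.1 ∧ optimism s.1 ≤ C * (t + 1 : ℕ))}
    have hbad : MeasurableSet bad :=
      ((measurable_fst measurableSet_isInteriorBelief).inter (measurableSet_le
        (measurable_optimism.comp measurable_fst) measurable_const)).compl
    have hpre : MeasurableSet (start (t + 1) ⁻¹' bad) := h.measurable_start (t + 1) hbad
    have hint : Integrable (fun ω => bad.indicator (1 : MarketState → ℝ) (start (t + 1) ω)) P :=
      (integrable_const (1 : ℝ)).indicator hpre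
    have hmean := (h.integral_start_succ hr hf (measurable_one.indicator hbad) hint).2
    have hzero : ∀ᵐ ω ∂P, learnMean r f μΘ μE (bad.indicator 1) (arrival t ω) = 0 := by
      filter_upwards [ih] with ω hω
      rw [← h.belief_arrival t ω] at hω
      refine Finset.sum_eq_zero fun z _ => ?_
      rcases (G_nonneg (r := r) (f := f) (μΘ := μΘ) (μE := μE) z (arrival t ω).1
        (arrival t ω).2).eq_or_lt with hz | hz
      · rw [← hz, zero_mul]
      · rw [Set.indicator_of_notMem, mul_zero]
        refine not_not.2 ⟨hω.1.stationaryUpdate (hident.G_pos hω.1.mem_stdSimplex hz), ?_⟩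
        push_cast
        linarith [hdrift.optimism_stationaryUpdate_le _ hω.1 z _ hz]
    rw [integral_congr_ae hzero, integral_zero] at hmean
    have hnull : P.real (start (t + 1) ⁻¹' bad) = 0 := by
      rw [← integral_indicator_one hpre, ← hmean]
      rfl
    filter_upwards [measure_eq_zero_iff_ae_notMem.1 ((measureReal_eq_zero_iff).1 hnull)] with ω hω
    exact not_not.1 hω

lemma ae_optimism_arrival_le (h : IsMarketChain r f μΘ μE η P start arrival)
    (hr : ∀ q, Measurable (r q)) (hf : ∀ q, Measurable fun x : Θ × E => f q x.1 x.2)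
    (hident : Identifiable r f μΘ μE) (hdrift : HasOptimismDrift r f μΘ μE k C) (t : ℕ) :
    ∀ᵐ ω ∂P, IsInteriorBelief (arrival t ω).1 ∧ optimism (arrival t ω).1 ≤ C * t := by
  simpa only [h.belief_arrival] using h.ae_optimism_start_le hr hf hident hdrift t

lemma integral_weightedOptimism_arrival (h : IsMarketChain r f μΘ μE η P start arrival)
    (hr : ∀ q, Measurable (r q)) (hf : ∀ q, Measurable fun x : Θ × E => f q x.1 x.2)
    (hident : Identifiable r f μΘ μE) (hdrift : HasOptimismDrift r f μΘ μE k C) (t : ℕ)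
    (w : Quality → ℝ) :
    ∫ ω, weightedOptimism w (arrival t ω) ∂P =
      (1 - η) * ∫ ω, weightedOptimism w (start t ω) ∂P +
        η / 2 * (w 0 + w 1) * ∫ ω, optimism (arrival t ω).1 ∂P := by
  have hbstart := (h.ae_optimism_start_le hr hf hident hdrift t).mono fun _ => And.right
  have hbarrival := (h.ae_optimism_arrival_le hr hf hident hdrift t).mono fun _ => And.right
  have hstart := integrable_weightedOptimism (h.measurable_start t) hbstart
  have hopt : Integrable (fun ω => optimism (start t ω).1) P := by
    simpa [weightedOptimism] using hstart 1
  rw [h.integral_arrival (measurable_weightedOptimism w)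
    (integrable_weightedOptimism (h.measurable_arrival t) hbarrival w)]
  have hmean (ω : Ω) : redrawMean η (weightedOptimism w) (start t ω) =
      (1 - η) * weightedOptimism w (start t ω) +
        η / 2 * (w 0 + w 1) * optimism (start t ω).1 := by
    simp only [redrawMean, weightedOptimism, Fin.sum_univ_two]
    ring
  simp only [hmean, h.belief_arrival]
  rw [integral_add ((hstart w).const_mul _) (hopt.const_mul _), integral_const_mul,
    integral_const_mul]

lemma integral_weightedOptimism_start_succ (h : IsMarketChain r f μΘ μE η P start arrival)
    (hr : ∀ q, Measurable (r q)) (hf : ∀ q, Measurable fun x : Θ × E => f q x.1 x.2)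
    (hident : Identifiable r f μΘ μE) (hdrift : HasOptimismDrift r f μΘ μE k C) (t : ℕ)
    {w : Quality → ℝ} (hw : ∀ q, w q ∈ Set.Icc 0 1) :
    ∫ ω, weightedOptimism w (arrival t ω) ∂P + k * w 1 / 2 ≤
      ∫ ω, weightedOptimism w (start (t + 1) ω) ∂P + C * meanLoss P arrival t := by
  have hae := h.ae_optimism_arrival_le hr hf hident hdrift t
  have hbstart := (h.ae_optimism_start_le hr hf hident hdrift (t + 1)).mono fun _ => And.right
  have harrival := integrable_weightedOptimism (h.measurable_arrival t)
    (hae.mono fun _ => And.right) w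
  obtain ⟨hmean, hsucc⟩ := h.integral_start_succ hr hf (measurable_weightedOptimism w)
    (integrable_weightedOptimism (h.measurable_start (t + 1)) hbstart w)
  have hloss := integrable_loss (h.measurable_arrival t) (hae.mono fun _ => And.left)
  set κ : Quality → ℝ := fun q => w q * if q = 1 then k else 0 with hκ
  have hκint : Integrable (fun ω => κ (arrival t ω).2) P :=
    (Integrable.of_finite (f := κ) (μ := P.map fun ω => (arrival t ω).2)).comp_measurable
      (h.measurable_arrival t).snd
  have hκmean : ∫ ω, κ (arrival t ω).2 ∂P = k * w 1 / 2 := by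
    have hquality := h.integral_quality_start (t + 1) κ
    simp only [h.quality_start_succ] at hquality
    rw [hquality]
    simp [hκ, mul_comm]
  rw [hsucc, ← hκmean, meanLoss, ← integral_const_mul, ← integral_add harrival hκint,
    ← integral_add hmean (hloss.const_mul C)]
  refine integral_mono_ae (harrival.add hκint) (hmean.add (hloss.const_mul C)) ?_
  filter_upwards [hae] with ω hω
  exact hdrift.weightedOptimism_add_le hw hω.1

lemma meanLoss_nonneg (h : IsMarketChain r f μΘ μE η P start arrival)
    (hr : ∀ q, Measurable (r q)) (hf : ∀ q, Measurable fun x : Θ × E => f q x.1 x.2)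
    (hident : Identifiable r f μΘ μE) (hdrift : HasOptimismDrift r f μΘ μE k C) (t : ℕ) :
    0 ≤ meanLoss P arrival t := by
  refine integral_nonneg_of_ae ?_
  filter_upwards [h.ae_optimism_arrival_le hr hf hident hdrift t] with ω hω
  exact sub_nonneg.2 (hω.1.le_one _)

lemma integral_weightedOptimism_low_le (h : IsMarketChain r f μΘ μE η P start arrival)
    (hr : ∀ q, Measurable (r q)) (hf : ∀ q, Measurable fun x : Θ × E => f q x.1 x.2)
    (hident : Identifiable r f μΘ μE) (hdrift : HasOptimismDrift r f μΘ μE k C) (t : ℕ) :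
    ∫ ω, weightedOptimism ![1, 0] (arrival t ω) ∂P ≤ 2 * C * t * meanLoss P arrival t := by
  have hae := h.ae_optimism_arrival_le hr hf hident hdrift t
  rw [meanLoss, ← integral_const_mul, mul_assoc 2]
  refine integral_mono_ae
    (integrable_weightedOptimism (h.measurable_arrival t) (hae.mono fun _ => And.right) _)
    ((integrable_loss (h.measurable_arrival t) (hae.mono fun _ => And.left)).const_mul _) ?_
  filter_upwards [hae] with ω hω
  exact weightedOptimism_low_le hω.1 hω.2

theorem mul_sq_le_mul_sum_meanLoss (h : IsMarketChain r f μΘ μE η P start arrival)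
    (hr : ∀ q, Measurable (r q)) (hf : ∀ q, Measurable fun x : Θ × E => f q x.1 x.2)
    (hident : Identifiable r f μΘ μE) (hdrift : HasOptimismDrift r f μΘ μE k C) (T : ℕ) :
    k * (η * T) * T ≤ 96 * C * (1 + η * T) * ∑ t ∈ Finset.range T, meanLoss P arrival t := by
  have hη := h.redraw_prob_mem_Icc
  have hC : 0 ≤ C := hdrift.pos.le.trans hdrift.le
  have hl := h.meanLoss_nonneg hr hf hident hdrift
  set a : ℕ → ℝ := fun t => ∫ ω, optimism (arrival t ω).1 ∂P
  set v : ℕ → ℝ := fun t => ∫ ω, weightedOptimism ![1, 0] (arrival t ω) ∂P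
  have ha₀ : 0 ≤ a 0 := integral_nonneg fun ω => optimism_nonneg _
  have hlow (q : Quality) : (![1, 0] : Quality → ℝ) q ∈ Set.Icc 0 1 := by fin_cases q <;> simp
  have hv₀ : 0 ≤ v 0 := integral_nonneg fun ω => mul_nonneg (hlow _).1 (optimism_nonneg _)
  have ha (t : ℕ) : a t + k / 2 ≤ a (t + 1) + 2 * C * meanLoss P arrival t := by
    have hstep := h.integral_weightedOptimism_start_succ hr hf hident hdrift t
      (w := 1) (by simp)
    simp only [weightedOptimism, Pi.one_apply, one_mul, mul_one, ← h.belief_arrival] at hstep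
    linarith [mul_nonneg hC (hl t)]
  have hv (t : ℕ) : η / 2 * a (t + 1) + (1 - η) * (v t - 2 * C * meanLoss P arrival t) ≤
      v (t + 1) := by
    have hstep := h.integral_weightedOptimism_start_succ hr hf hident hdrift t hlow
    have hredraw := h.integral_weightedOptimism_arrival hr hf hident hdrift (t + 1) ![1, 0]
    simp only [Matrix.cons_val_zero, Matrix.cons_val_one, Matrix.cons_val_fin_one, mul_zero,
      zero_div, add_zero, mul_one] at hstep hredraw
    calc _ ≤ η / 2 * a (t + 1) +
          (1 - η) * ∫ ω, weightedOptimism ![1, 0] (start (t + 1) ω) ∂P := by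
          gcongr
          exacts [sub_nonneg.2 hη.2, by linarith [mul_nonneg hC (hl t)]]
      _ = v (t + 1) := by rw [add_comm, ← hredraw]
  have hmain := mul_sq_le_mul_sum hη.1 (by positivity) hl ha₀ hv₀ ha hv
    (h.integral_weightedOptimism_low_le hr hf hident hdrift)
    (by rw [h.meanLoss_zero]; linarith [hdrift.le, hdrift.pos]) T
  linarith

end IsMarketChain

end Chain

section DynamicModel

variable {Ω : Type*} {θ : ℕ → Ω → Θ} {ε : ℕ → Ω → E} {X : ℕ → Ω → Quality} {B : ℕ → Ω → Bool}

/-- The belief of consumer `t + 1` together with the quality at time `t`. -/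
def startState (r : Quality → Θ → ℝ) (f : Quality → Θ → E → 𝓩) (μΘ : Measure Θ) (μE : Measure E)
    (θ : ℕ → Ω → Θ) (ε : ℕ → Ω → E) (X : ℕ → Ω → Quality) (B : ℕ → Ω → Bool) (t : ℕ) (ω : Ω) :
    MarketState :=
  (posteriorImp r f μΘ μE θ ε (quality X B) (t + 1) ω, quality X B t ω)

/-- The belief of consumer `t + 1` together with the quality that she meets. -/
def arrivalState (r : Quality → Θ → ℝ) (f : Quality → Θ → E → 𝓩) (μΘ : Measure Θ) (μE : Measure E)
    (θ : ℕ → Ω → Θ) (ε : ℕ → Ω → E) (X : ℕ → Ω → Quality) (B : ℕ → Ω → Bool) (t : ℕ) (ω : Ω) :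
    MarketState :=
  (posteriorImp r f μΘ μE θ ε (quality X B) (t + 1) ω, quality X B (t + 1) ω)

lemma arrivalState_eq (t : ℕ) (ω : Ω) : arrivalState r f μΘ μE θ ε X B t ω =
    redraw (startState r f μΘ μE θ ε X B t ω, X (t + 1) ω, B (t + 1) ω) := rfl

lemma startState_succ (t : ℕ) (ω : Ω) : startState r f μΘ μE θ ε X B (t + 1) ω =
    learn r f μΘ μE (arrivalState r f μΘ μE θ ε X B t ω, θ (t + 1) ω, ε (t + 1) ω) := rfl

variable [MeasurableSpace Ω] {P : Measure Ω} {η : ℝ}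

lemma lossImp_eq_sum_meanLoss (T : ℕ) : lossImp r f μΘ μE P θ ε X B T =
    ∑ t ∈ Finset.range T, meanLoss P (arrivalState r f μΘ μE θ ε X B) t := by
  rw [lossImp, ← Finset.Ico_add_one_right_eq_Icc, Finset.sum_Ico_eq_sum_range,
    Nat.add_sub_cancel]
  simp only [meanLoss, arrivalState, add_comm 1]

namespace IsDynamicModel

variable (h : IsDynamicModel P μΘ μE η θ ε X B)
include h

lemma measurable_input (t : ℕ) : Measurable fun ω => (θ t ω, ε t ω, X t ω, B t ω) :=
  (h.measurable_preference t).prodMk <| (h.measurable_noise t).prodMk <|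
    (h.measurable_draw t).prodMk (h.measurable_coin t)

lemma hasLaw_consumer_redraw [SFinite μΘ] [SFinite μE] (t : ℕ) :
    HasLaw (fun ω => ((θ t ω, ε t ω), X t ω, B t ω)) ((μΘ.prod μE).prod (redrawLaw η)) P := by
  have hinput : HasLaw (fun ω => (θ t ω, ε t ω, X t ω, B t ω))
      (μΘ.prod (μE.prod (redrawLaw η))) P := ⟨(h.measurable_input t).aemeasurable, h.law t⟩
  exact (measurePreserving_prodAssoc μΘ μE (redrawLaw η)).symm.fun_comp_hasLaw hinput

lemma hasLaw_redraw [IsProbabilityMeasure μΘ] [IsProbabilityMeasure μE] (t : ℕ) :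
    HasLaw (fun ω => (X t ω, B t ω)) (redrawLaw η) P :=
  measurePreserving_snd.fun_comp_hasLaw (h.hasLaw_consumer_redraw t)

section ConsumerRedraw

variable [IsProbabilityMeasure P] [IsProbabilityMeasure μΘ] [IsProbabilityMeasure μE]

lemma isProbabilityMeasure_redrawLaw : IsProbabilityMeasure (redrawLaw η) :=
  have := (h.hasLaw_consumer_redraw 0).isProbabilityMeasure_iff.1 inferInstance
  isProbabilityMeasure_right_of_prod (μΘ.prod μE) (redrawLaw η)

lemma hasLaw_consumer (t : ℕ) : HasLaw (fun ω => (θ t ω, ε t ω)) (μΘ.prod μE) P :=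
  have := h.isProbabilityMeasure_redrawLaw
  measurePreserving_fst.fun_comp_hasLaw (h.hasLaw_consumer_redraw t)

lemma hasLaw_draw (t : ℕ) : HasLaw (X t) (uniformOn Set.univ) P := by
  have := h.isProbabilityMeasure_redrawLaw
  rw [redrawLaw] at this
  have := isProbabilityMeasure_right_of_prod (uniformOn (Set.univ : Set Quality)) (coinLaw η)
  exact measurePreserving_fst.fun_comp_hasLaw (h.hasLaw_redraw t)

lemma indepFun_redraw_consumer (t : ℕ) :
    IndepFun (fun ω => (X t ω, B t ω)) (fun ω => (θ t ω, ε t ω)) P :=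
  ((indepFun_iff_hasLaw_prodMk_prod (h.hasLaw_consumer t) (h.hasLaw_redraw t)).2
    (h.hasLaw_consumer_redraw t)).symm

end ConsumerRedraw

variable [IsProbabilityMeasure μΘ] [IsProbabilityMeasure μE]
  [Countable 𝓩] [MeasurableSpace 𝓩] [MeasurableSingletonClass 𝓩]

lemma measurable_startState_and_indepFun
    (hr : ∀ q, Measurable (r q)) (hf : ∀ q, Measurable fun x : Θ × E => f q x.1 x.2) (t : ℕ) :
    Measurable (startState r f μΘ μE θ ε X B t) ∧
      IndepFun (startState r f μΘ μE θ ε X B t)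
        (fun ω => (θ (t + 1) ω, ε (t + 1) ω, X (t + 1) ω, B (t + 1) ω)) P :=
  have hlearn := measurable_learn (μΘ := μΘ) (μE := μE) hr hf
  measurable_and_indepFun_of_recursion h.measurable_input h.indep
    (φ := fun u => (prior, u.2.2.1)) (by fun_prop)
    (F := fun y => learn r f μΘ μE (redraw (y.1, y.2.2.2), y.2.1, y.2.2.1))
    (hlearn.comp ((measurable_redraw.comp (by fun_prop)).prodMk (by fun_prop)))
    (fun _ => rfl) (fun _ _ => rfl) t

lemma isMarketChain [IsProbabilityMeasure P] (hr : ∀ q, Measurable (r q))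
    (hf : ∀ q, Measurable fun x : Θ × E => f q x.1 x.2) :
    IsMarketChain r f μΘ μE η P (startState r f μΘ μE θ ε X B)
      (arrivalState r f μΘ μE θ ε X B) where
  measurable_start t := (h.measurable_startState_and_indepFun hr hf t).1
  measurable_arrival t := measurable_redraw.comp <|
    (h.measurable_startState_and_indepFun hr hf t).1.prodMk (h.measurable_input (t + 1)).snd.snd
  belief_zero _ := rfl
  hasLaw_quality_zero := h.hasLaw_draw 0
  arrival_eq t := ⟨_, h.hasLaw_redraw (t + 1),
    (h.measurable_startState_and_indepFun hr hf t).2.comp measurable_id measurable_snd.snd,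
    arrivalState_eq t⟩
  start_succ_eq t := by
    refine ⟨_, h.hasLaw_consumer (t + 1), ?_, startState_succ t⟩
    obtain ⟨hstart, hind⟩ := h.measurable_startState_and_indepFun (r := r) (f := f) hr hf t
    have hredraw := h.hasLaw_redraw (t + 1)
    have hconsumer := h.hasLaw_consumer (t + 1)
    have hswap : Measurable fun u : Θ × E × Quality × Bool => (u.2.2, u.1, u.2.1) := by fun_prop
    exact (indepFun_prodMk_left hstart.aemeasurable hredraw.aemeasurable hconsumer.aemeasurable
      (hind.comp measurable_id hswap) (h.indepFun_redraw_consumer (t + 1))).comp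
      measurable_redraw measurable_id

end IsDynamicModel

end DynamicModel

end Feedback

end SocialLearning

end

open SocialLearning in
theorem mainTheorem5_general {Θ E 𝓩 : Type*} [MeasurableSpace Θ] [MeasurableSpace E]
    [Finite 𝓩] [MeasurableSpace 𝓩] [MeasurableSingletonClass 𝓩]
    (r : Quality → Θ → ℝ) (hr : ∀ q, Measurable (r q)) (f : Quality → Θ → E → 𝓩)
    (hf : ∀ q, Measurable (fun x : Θ × E => f q x.1 x.2))
    (μΘ : Measure Θ) [IsProbabilityMeasure μΘ] (μE : Measure E) [IsProbabilityMeasure μE]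
    (hcross : ∀ θ, 0 < r 0 θ → 0 < r 1 θ) (hident : Identifiable r f μΘ μE) :
    ∀ c₀ : ℝ, 0 < c₀ → ∃ c : ℝ, 0 < c ∧
      ∀ (T : ℕ) (η : ℝ), c₀ ≤ η * T →
        ∀ {Ω : Type*} [MeasurableSpace Ω] (P : Measure Ω) [IsProbabilityMeasure P]
          (θ : ℕ → Ω → Θ) (ε : ℕ → Ω → E) (X : ℕ → Ω → Quality) (B : ℕ → Ω → Bool),
          IsDynamicModel P μΘ μE η θ ε X B → c * T ≤ lossImp r f μΘ μE P θ ε X B T := by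
  intro c₀ hc₀
  have := Fintype.ofFinite 𝓩
  obtain ⟨k, C, hdrift⟩ := hident.exists_hasOptimismDrift hr hf hcross
  have hk := hdrift.pos
  have hC : 0 < C := hk.trans_le hdrift.le
  refine ⟨k * (c₀ / (1 + c₀)) / (96 * C), by positivity, fun T η hT Ω _ P _ θ ε X B hmodel => ?_⟩
  have hloss := (hmodel.isMarketChain hr hf).mul_sq_le_mul_sum_meanLoss hr hf hident hdrift T
  rw [← lossImp_eq_sum_meanLoss] at hloss
  set L := lossImp r f μΘ μE P θ ε X B T
  have hηT : 0 < 1 + η * T := by linarith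
  have hratio : c₀ / (1 + c₀) ≤ η * T / (1 + η * T) := by
    rw [div_le_div_iff₀ (by positivity) hηT]
    linarith
  calc k * (c₀ / (1 + c₀)) / (96 * C) * T
      ≤ k * (η * T / (1 + η * T)) / (96 * C) * T := by gcongr
    _ = k * (η * T) * T / (96 * C * (1 + η * T)) := by field_simp
    _ ≤ L := (div_le_iff₀ (by positivity)).2 (by linarith)

theorem mainTheorem5 {Θ E 𝓩 : Type*} [MeasurableSpace Θ] [MeasurableSpace E]
    [Fintype 𝓩] [MeasurableSpace 𝓩] [MeasurableSingletonClass 𝓩]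
    (r : SocialLearning.Quality → Θ → ℝ) (hr : ∀ q, Measurable (r q))
    (f : SocialLearning.Quality → Θ → E → 𝓩)
    (hf : ∀ q, Measurable (fun x : Θ × E => f q x.1 x.2))
    (μΘ : Measure Θ) [IsProbabilityMeasure μΘ] (μE : Measure E) [IsProbabilityMeasure μE]
    (hpurchase : SocialLearning.PurchaseGuarantee r μΘ)
    (hident : SocialLearning.Identifiable r f μΘ μE) :
    ∀ c₀ : ℝ, 0 < c₀ → ∃ c : ℝ, 0 < c ∧
      ∀ (T : ℕ) (η : ℝ), 1 ≤ T → 0 < η → η < 1 / 2 → c₀ ≤ η * T →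
        ∀ {Ω : Type*} [MeasurableSpace Ω] (P : Measure Ω) [IsProbabilityMeasure P]
          (θ : ℕ → Ω → Θ) (ε : ℕ → Ω → E)
          (X : ℕ → Ω → SocialLearning.Quality) (B : ℕ → Ω → Bool),
          SocialLearning.IsDynamicModel P μΘ μE η θ ε X B →
            c * T ≤ SocialLearning.lossImp r f μΘ μE P θ ε X B T := by
  intro c₀ hc₀
  have hcross (θ : Θ) (h : 0 < r 0 θ) : 0 < r 1 θ := h.trans_le (hpurchase.1 θ (by decide))
  obtain ⟨c, hc, hloss⟩ := mainTheorem5_general r hr f hf μΘ μE hcross hident c₀ hc₀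
  exact ⟨c, hc, fun T η _ _ _ hT => hloss T η hT⟩
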